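/- Let $M$ be a smooth manifold of dimension $2n+s$ with a smooth Riemannian metric $g$ and Levi-Civita connection $\nabla$, a smooth $(1,1)$-tensor field $\varphi$, smooth vector fields $\xi_1,\dots,\xi_s$ and smooth $1$-forms $\eta^1,\dots,\eta^s$ such that, for all tangent vectors $X,Y$ and all $\alpha,\beta$, $$\varphi^2X=-X+\sum_{\alpha}\eta^\alpha(X)\xi_\alpha,\quad \eta^\alpha(\xi_\beta)=\delta^\alpha_\beta,\quad \varphi\xi_\alpha=0,\quad \eta^\alpha(\varphi X)=0,\quad \eta^\alpha(X)=g(X,\xi_\alpha),$$ $$g(\varphi X,\varphi Y)=g(X,Y)-\sum_\alpha\eta^\alpha(X)\eta^\alpha(Y).$$ Suppose that $M$ is a $C$-manifold: the structure is normal, i.e. the Nijenhuis tensor of $\varphi$ satisfies $N_\varphi=-2\sum_\alpha d\eta^\alpha\otimes\xi_\alpha$, the $2$-form $\Omega(X,Y)=g(X,\varphi Y)$ is closed, and every $\eta^\alpha$ is closed. Let $\gamma:I\to M$ be a smooth unit-speed curve on a non-degenerate interval $I$ which is a Legendre $\varphi$-helix, that is: - (Legendre) $T=\gamma'$ is $g$-orthogonal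 to $\xi_1,\dots,\xi_s$; - (Frenet equations of order $3$) there are smooth vector fields $v_2,v_3$ along $\gamma$ such that $T,v_2,v_3$ are orthonormal and $$\nabla_TT=\kappa_1v_2,\qquad \nabla_Tv_2=-\kappa_1T+\kappa_2v_3,\qquad \nabla_Tv_3=-\kappa_2v_2;$$ - $\kappa_1>0$ and $\kappa_2\ge 0$ are constant; - $\operatorname{span}\{T,v_2,v_3\}$ is $\varphi$-invariant at every point of $\gamma$. Then $\kappa_2=0$. Hence $\gamma$ is a Legendre $\varphi$-circle: $T\perp\xi_\alpha$ for all $\alpha$, $\nabla_TT=\kappa_1v_2$ and $\nabla_Tv_2=-\kappa_1T$ with $T,v_2$ orthonormal and $\kappa_1>0$ constant, and $\operatorname{span}\{T,v_2,\xi_1,\dots,\xi_s\}$ is $\varphi$-invariant at every point of $\gamma$. (In particular, there is no Legendre $\varphi$-helix with $\kappa_2>0$.) -/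

import Mathlib

open Bundle Set VectorField
open scoped Manifold ContDiff

noncomputable section

namespace CMfd

section Tensors

variable {E : Type*} [NormedAddCommGroup E] [NormedSpace ℝ E]
  {M : Type*} [TopologicalSpace M] [ChartedSpace E M] [IsManifold 𝓘(ℝ, E) ∞ M]

variable (E M) in
/-- A smooth Riemannian metric on the manifold `M`. -/
abbrev Metric : Type _ :=
  ContMDiffRiemannianMetric 𝓘(ℝ, E) ∞ E (fun x : M => TangentSpace 𝓘(ℝ, E) x)

/-- `X` is a smooth vector field on the set `U`. -/
def SmoothFieldOn (X : ∀ x : M, TangentSpace 𝓘(ℝ, E) x) (U : Set M) : Prop :=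
  ContMDiffOn 𝓘(ℝ, E) 𝓘(ℝ, E).tangent ∞ (fun x => (⟨x, X x⟩ : TangentBundle 𝓘(ℝ, E) M)) U

/-- The derivative `X_x(f)` of a real function `f` in the direction of the vector field `X`. -/
def dirDeriv (X : ∀ x : M, TangentSpace 𝓘(ℝ, E) x) (f : M → ℝ) (x : M) : ℝ :=
  mfderiv 𝓘(ℝ, E) 𝓘(ℝ, ℝ) f x (X x)

/-- The exterior derivative of a 1-form, evaluated on two vector fields:
`dη(X, Y) = ½ (X η(Y) - Y η(X) - η([X, Y]))`. -/
def extDerivOne (η : ∀ x : M, TangentSpace 𝓘(ℝ, E) x →L[ℝ] ℝ)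
    (X Y : ∀ x : M, TangentSpace 𝓘(ℝ, E) x) (x : M) : ℝ :=
  (1 / 2) * (dirDeriv X (fun y => η y (Y y)) x - dirDeriv Y (fun y => η y (X y)) x
    - η x (mlieBracket 𝓘(ℝ, E) X Y x))

/-- The exterior derivative of a 2-form, evaluated on three vector fields:
`dΘ(X, Y, Z) = ⅓ (X Θ(Y, Z) + Y Θ(Z, X) + Z Θ(X, Y) - Θ([X, Y], Z) - Θ([Y, Z], X) - Θ([Z, X], Y))`.
-/
def extDerivTwo
    (Θ : ∀ x : M, TangentSpace 𝓘(ℝ, E) x → TangentSpace 𝓘(ℝ, E) x → ℝ)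
    (X Y Z : ∀ x : M, TangentSpace 𝓘(ℝ, E) x) (x : M) : ℝ :=
  (1 / 3) * (dirDeriv X (fun y => Θ y (Y y) (Z y)) x
    + dirDeriv Y (fun y => Θ y (Z y) (X y)) x
    + dirDeriv Z (fun y => Θ y (X y) (Y y)) x
    - Θ x (mlieBracket 𝓘(ℝ, E) X Y x) (Z x)
    - Θ x (mlieBracket 𝓘(ℝ, E) Y Z x) (X x)
    - Θ x (mlieBracket 𝓘(ℝ, E) Z X x) (Y x))

/-- The Nijenhuis tensor of a (1,1)-tensor field, evaluated on two vector fields: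
`N(X, Y) = φ²[X, Y] + [φX, φY] - φ[φX, Y] - φ[X, φY]`. -/
def nijenhuis (φ : ∀ x : M, TangentSpace 𝓘(ℝ, E) x →L[ℝ] TangentSpace 𝓘(ℝ, E) x)
    (X Y : ∀ x : M, TangentSpace 𝓘(ℝ, E) x) (x : M) : TangentSpace 𝓘(ℝ, E) x :=
  φ x (φ x (mlieBracket 𝓘(ℝ, E) X Y x))
    + mlieBracket 𝓘(ℝ, E) (fun y => φ y (X y)) (fun y => φ y (Y y)) x
    - φ x (mlieBracket 𝓘(ℝ, E) (fun y => φ y (X y)) Y x)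
    - φ x (mlieBracket 𝓘(ℝ, E) X (fun y => φ y (Y y)) x)

end Tensors

section Structures

variable {E : Type*} [NormedAddCommGroup E] [NormedSpace ℝ E]
  {M : Type*} [TopologicalSpace M] [ChartedSpace E M] [IsManifold 𝓘(ℝ, E) ∞ M]

/-- `(φ, ξ_α, η^α, g)` is a framed `φ`-structure on `M`. -/
structure IsFramedPhiStructure {s : ℕ} (g : Metric E M)
    (φ : ∀ x : M, TangentSpace 𝓘(ℝ, E) x →L[ℝ] TangentSpace 𝓘(ℝ, E) x)
    (ξ : Fin s → ∀ x : M, TangentSpace 𝓘(ℝ, E) x)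
    (η : Fin s → ∀ x : M, TangentSpace 𝓘(ℝ, E) x →L[ℝ] ℝ) : Prop where
  smooth_phi : ContMDiff 𝓘(ℝ, E) (𝓘(ℝ, E).prod 𝓘(ℝ, E →L[ℝ] E)) ∞
    (fun x => TotalSpace.mk' (E →L[ℝ] E)
      (E := fun x : M => TangentSpace 𝓘(ℝ, E) x →L[ℝ] TangentSpace 𝓘(ℝ, E) x) x (φ x))
  smooth_xi : ∀ α, SmoothFieldOn (ξ α) univ
  smooth_eta : ∀ α, ContMDiff 𝓘(ℝ, E) (𝓘(ℝ, E).prod 𝓘(ℝ, E →L[ℝ] ℝ)) ∞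
    (fun x => TotalSpace.mk' (E →L[ℝ] ℝ)
      (E := fun x : M => TangentSpace 𝓘(ℝ, E) x →L[ℝ] ℝ) x (η α x))
  phi_sq : ∀ (x : M) (u : TangentSpace 𝓘(ℝ, E) x),
    φ x (φ x u) = -u + ∑ α, η α x u • ξ α x
  eta_xi : ∀ (α β : Fin s) (x : M), η α x (ξ β x) = if α = β then 1 else 0
  phi_xi : ∀ (α : Fin s) (x : M), φ x (ξ α x) = 0
  eta_phi : ∀ (α : Fin s) (x : M) (u : TangentSpace 𝓘(ℝ, E) x), η α x (φ x u) = 0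
  eta_eq : ∀ (α : Fin s) (x : M) (u : TangentSpace 𝓘(ℝ, E) x), η α x u = g.inner x u (ξ α x)
  metric_phi : ∀ (x : M) (u v : TangentSpace 𝓘(ℝ, E) x),
    g.inner x (φ x u) (φ x v) = g.inner x u v - ∑ α, η α x u * η α x v

/-- `(M, φ, ξ_α, η^α, g)` is a `C`-manifold: the framed `φ`-structure is normal, and the
fundamental 2-form `Ω(X, Y) = g(X, φY)` and all the 1-forms `η^α` are closed. The tensor identities
are tested on all locally defined smooth vector fields. -/
structure IsCManifold {s : ℕ} (g : Metric E M)
    (φ : ∀ x : M, TangentSpace 𝓘(ℝ, E) x →L[ℝ] TangentSpace 𝓘(ℝ, E) x)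
    (ξ : Fin s → ∀ x : M, TangentSpace 𝓘(ℝ, E) x)
    (η : Fin s → ∀ x : M, TangentSpace 𝓘(ℝ, E) x →L[ℝ] ℝ) : Prop
    extends IsFramedPhiStructure g φ ξ η where
  normal : ∀ (U : Set M) (X Y : ∀ x : M, TangentSpace 𝓘(ℝ, E) x), IsOpen U →
    SmoothFieldOn X U → SmoothFieldOn Y U → ∀ x ∈ U,
      nijenhuis φ X Y x = (-2 : ℝ) • ∑ α, extDerivOne (η α) X Y x • ξ α x
  closed_omega : ∀ (U : Set M) (X Y Z : ∀ x : M, TangentSpace 𝓘(ℝ, E) x), IsOpen U →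
    SmoothFieldOn X U → SmoothFieldOn Y U → SmoothFieldOn Z U → ∀ x ∈ U,
      extDerivTwo (fun y u v => g.inner y u (φ y v)) X Y Z x = 0
  closed_eta : ∀ (α : Fin s) (U : Set M) (X Y : ∀ x : M, TangentSpace 𝓘(ℝ, E) x), IsOpen U →
    SmoothFieldOn X U → SmoothFieldOn Y U → ∀ x ∈ U, extDerivOne (η α) X Y x = 0

end Structures

section Connection

variable {E : Type*} [NormedAddCommGroup E] [NormedSpace ℝ E]
  {M : Type*} [TopologicalSpace M] [ChartedSpace E M] [IsManifold 𝓘(ℝ, E) ∞ M]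

/-- The metric read in the chart at `x`: for `y` in the target of that chart, this is the bilinear
form on `E` obtained by pulling `g` back along the inverse of the chart. -/
def metricInChart (g : Metric E M) (x : M) (y : E) : E →L[ℝ] E →L[ℝ] ℝ :=
  let z : M := (extChartAt 𝓘(ℝ, E) x).symm y
  let G : E →L[ℝ] E →L[ℝ] ℝ := g.inner z
  let A : E →L[ℝ] E := (trivializationAt E (TangentSpace 𝓘(ℝ, E) : M → Type _) x).symmL ℝ z
  G.bilinearComp A A

/-- The right-hand side of the formula for the Christoffel symbols of the first kind at `x`, as a
linear form in the last argument:
`w ↦ ½ (∂_u g(v, w) + ∂_v g(u, w) - ∂_w g(u, v))`, computed in the chart at `x`. -/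
def christoffelForm (g : Metric E M) (x : M) (u v : TangentSpace 𝓘(ℝ, E) x) :
    TangentSpace 𝓘(ℝ, E) x →L[ℝ] ℝ :=
  let D : E →L[ℝ] E →L[ℝ] E →L[ℝ] ℝ :=
    fderiv ℝ (E := E) (F := E →L[ℝ] E →L[ℝ] ℝ) (metricInChart g x) (extChartAt 𝓘(ℝ, E) x x)
  let L : E → E → E →L[ℝ] ℝ := fun a b => (1 / 2 : ℝ) • (D a b + D b a - (D.flip a).flip b)
  L u v

/-- The Christoffel symbols (of the second kind) of the Levi-Civita connection of `g` at `x`, in the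
chart at `x`, as a bilinear map: `christoffel g x u v = Γ^k_{ij} u^i v^j ∂_k`. It is obtained by
raising an index of `christoffelForm` with the inverse of the metric at `x`. The tangent space at
`x` is identified with `E` through the chart at `x`, as everywhere in Mathlib. -/
def christoffel (g : Metric E M) (x : M) (u v : TangentSpace 𝓘(ℝ, E) x) :
    TangentSpace 𝓘(ℝ, E) x :=
  let G : E →L[ℝ] E →L[ℝ] ℝ := g.inner x
  G.inverse (christoffelForm g x u v)

/-- The defining property of the Christoffel symbols. -/
theorem inner_christoffel [FiniteDimensional ℝ E] (g : Metric E M) (x : M)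
    (u v w : TangentSpace 𝓘(ℝ, E) x) :
    g.inner x (christoffel g x u v) w = christoffelForm g x u v w := by
  let G : E →L[ℝ] E →L[ℝ] ℝ := g.inner x
  have hinj : Function.Injective G.toLinearMap := by
    rw [← LinearMap.ker_eq_bot, LinearMap.ker_eq_bot']
    intro a ha
    by_contra hne
    have h1 : 0 < G a a := g.pos x a hne
    have h2 : G a = 0 := ha
    rw [h2] at h1
    simp at h1
  have hrank : Module.finrank ℝ E = Module.finrank ℝ (E →L[ℝ] ℝ) := by
    rw [← (LinearMap.toContinuousLinearMap (𝕜 := ℝ) (E := E) (F' := ℝ)).finrank_eq]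
    exact (Subspace.dual_finrank_eq (K := ℝ) (V := E)).symm
  have hinv : G.IsInvertible :=
    ⟨(LinearEquiv.ofInjectiveOfFinrankEq G.toLinearMap hinj hrank).toContinuousLinearEquiv, by
      ext a b; rfl⟩
  exact DFunLike.congr_fun (hinv.self_apply_inverse (christoffelForm g x u v)) w

/-- The velocity `γ'(t)` of a curve `γ : J → M`. -/
def velocity (γ : ℝ → M) (J : Set ℝ) (t : ℝ) : TangentSpace 𝓘(ℝ, E) (γ t) :=
  mfderivWithin 𝓘(ℝ, ℝ) 𝓘(ℝ, E) γ J t (1 : ℝ)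

/-- The covariant derivative `∇_{γ'} V` (Levi-Civita connection of `g`) of a vector field `V` along
a curve `γ : J → M`. At time `t` it is computed in the chart at `γ t`:
`(∇_{γ'} V)^k = (V^k)' + Γ^k_{ij} (γ^i)' V^j`. -/
def covDerivAlong (g : Metric E M) (γ : ℝ → M) (J : Set ℝ)
    (V : ∀ t : ℝ, TangentSpace 𝓘(ℝ, E) (γ t)) (t : ℝ) : TangentSpace 𝓘(ℝ, E) (γ t) :=
  let W : ℝ → E := fun r =>
    (trivializationAt E (TangentSpace 𝓘(ℝ, E) : M → Type _) (γ t) ⟨γ r, V r⟩).2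
  let a : TangentSpace 𝓘(ℝ, E) (γ t) := derivWithin W J t
  a + christoffel g (γ t) (velocity γ J t) (V t)

/-- `V` is a smooth vector field along the curve `γ : J → M`. -/
def SmoothAlong (γ : ℝ → M) (J : Set ℝ) (V : ∀ t : ℝ, TangentSpace 𝓘(ℝ, E) (γ t)) : Prop :=
  ContMDiffOn 𝓘(ℝ, ℝ) 𝓘(ℝ, E).tangent ∞
    (fun t => (⟨γ t, V t⟩ : TangentBundle 𝓘(ℝ, E) M)) J

end Connection

section Curves

variable {E : Type*} [NormedAddCommGroup E] [NormedSpace ℝ E]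
  {M : Type*} [TopologicalSpace M] [ChartedSpace E M] [IsManifold 𝓘(ℝ, E) ∞ M]

/-- `γ : J → M` is a smooth unit-speed curve on an interval `J` (with more than one point). -/
structure IsUnitSpeedCurve (g : Metric E M) (γ : ℝ → M) (J : Set ℝ) : Prop where
  interval : J.OrdConnected
  nontrivial : J.Nontrivial
  smooth : ContMDiffOn 𝓘(ℝ, ℝ) 𝓘(ℝ, E) ∞ γ J
  unit_speed : ∀ t ∈ J,
    g.inner (γ t) (velocity (E := E) γ J t) (velocity (E := E) γ J t) = 1

/-- `γ : J → M` is a Frenet curve of osculating order 2, with Frenet frame `{T = γ', v₂}` and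
curvature `κ₁ > 0`. -/
structure IsFrenetTwo (g : Metric E M) (γ : ℝ → M) (J : Set ℝ)
    (v₂ : ∀ t : ℝ, TangentSpace 𝓘(ℝ, E) (γ t)) (κ₁ : ℝ → ℝ) : Prop
    extends IsUnitSpeedCurve g γ J where
  smooth_two : SmoothAlong γ J v₂
  norm_two : ∀ t ∈ J, g.inner (γ t) (v₂ t) (v₂ t) = 1
  orth_one_two : ∀ t ∈ J, g.inner (γ t) (velocity γ J t) (v₂ t) = 0
  curv_one_pos : ∀ t ∈ J, 0 < κ₁ t
  frenet_one : ∀ t ∈ J, covDerivAlong g γ J (velocity γ J) t = κ₁ t • v₂ t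
  frenet_two : ∀ t ∈ J, covDerivAlong g γ J v₂ t = -(κ₁ t • velocity γ J t)

/-- `γ : J → M` satisfies the Frenet equations of order 3 with the orthonormal Frenet frame
`{T = γ', v₂, v₃}` and curvatures `κ₁ > 0` and `κ₂ ≥ 0`. The value `κ₂ = 0` is allowed, so that this
comprises the curves of osculating order 3 (where `κ₂ > 0`) and the degenerate ones. -/
structure IsFrenetThree (g : Metric E M) (γ : ℝ → M) (J : Set ℝ)
    (v₂ v₃ : ∀ t : ℝ, TangentSpace 𝓘(ℝ, E) (γ t)) (κ₁ κ₂ : ℝ → ℝ) : Prop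
    extends IsUnitSpeedCurve g γ J where
  smooth_two : SmoothAlong γ J v₂
  smooth_three : SmoothAlong γ J v₃
  norm_two : ∀ t ∈ J, g.inner (γ t) (v₂ t) (v₂ t) = 1
  norm_three : ∀ t ∈ J, g.inner (γ t) (v₃ t) (v₃ t) = 1
  orth_one_two : ∀ t ∈ J, g.inner (γ t) (velocity γ J t) (v₂ t) = 0
  orth_one_three : ∀ t ∈ J, g.inner (γ t) (velocity γ J t) (v₃ t) = 0
  orth_two_three : ∀ t ∈ J, g.inner (γ t) (v₂ t) (v₃ t) = 0
  curv_one_pos : ∀ t ∈ J, 0 < κ₁ t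
  curv_two_nonneg : ∀ t ∈ J, 0 ≤ κ₂ t
  frenet_one : ∀ t ∈ J, covDerivAlong g γ J (velocity γ J) t = κ₁ t • v₂ t
  frenet_two : ∀ t ∈ J,
    covDerivAlong g γ J v₂ t = -(κ₁ t • velocity γ J t) + κ₂ t • v₃ t
  frenet_three : ∀ t ∈ J, covDerivAlong g γ J v₃ t = -(κ₂ t • v₂ t)

/-- A function is constant on `J`. -/
def ConstantOn (κ : ℝ → ℝ) (J : Set ℝ) : Prop := ∃ c : ℝ, ∀ t ∈ J, κ t = c

/-- `γ : J → M` is a Legendre curve: its velocity is orthogonal to all the fields `ξ_α`. -/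
def IsLegendre {s : ℕ} (g : Metric E M) (ξ : Fin s → ∀ x : M, TangentSpace 𝓘(ℝ, E) x)
    (γ : ℝ → M) (J : Set ℝ) : Prop :=
  ∀ t ∈ J, ∀ α, g.inner (γ t) (velocity γ J t) (ξ α (γ t)) = 0

/-- A `φ`-helix (of order 3): the curvatures `κ₁`, `κ₂` are constant and `span {T, v₂, v₃}` is
`φ`-invariant. -/
structure IsPhiHelix (g : Metric E M)
    (φ : ∀ x : M, TangentSpace 𝓘(ℝ, E) x →L[ℝ] TangentSpace 𝓘(ℝ, E) x)
    (γ : ℝ → M) (J : Set ℝ) (v₂ v₃ : ∀ t : ℝ, TangentSpace 𝓘(ℝ, E) (γ t)) (κ₁ κ₂ : ℝ → ℝ) : Prop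
    extends IsFrenetThree g γ J v₂ v₃ κ₁ κ₂ where
  const_one : ConstantOn κ₁ J
  const_two : ConstantOn κ₂ J
  invariant : ∀ t ∈ J,
    ∀ w ∈ Submodule.span ℝ {velocity (E := E) γ J t, v₂ t, v₃ t},
      φ (γ t) w ∈ Submodule.span ℝ {velocity (E := E) γ J t, v₂ t, v₃ t}

/-- A `φ`-circle, that is, a `φ`-helix of order 2: the curvature `κ₁` is constant and
`span {T, v₂, ξ_1, …, ξ_s}` is `φ`-invariant. -/
structure IsPhiCircle {s : ℕ} (g : Metric E M)
    (φ : ∀ x : M, TangentSpace 𝓘(ℝ, E) x →L[ℝ] TangentSpace 𝓘(ℝ, E) x)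
    (ξ : Fin s → ∀ x : M, TangentSpace 𝓘(ℝ, E) x)
    (γ : ℝ → M) (J : Set ℝ) (v₂ : ∀ t : ℝ, TangentSpace 𝓘(ℝ, E) (γ t)) (κ₁ : ℝ → ℝ) : Prop
    extends IsFrenetTwo g γ J v₂ κ₁ where
  const_one : ConstantOn κ₁ J
  invariant : ∀ t ∈ J,
    ∀ w ∈ Submodule.span ℝ
        ({velocity (E := E) γ J t, v₂ t} ∪ range (fun α => ξ α (γ t))),
      φ (γ t) w ∈ Submodule.span ℝ
        ({velocity (E := E) γ J t, v₂ t} ∪ range (fun α => ξ α (γ t)))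

end Curves

end CMfd

end

/-!
A Legendre curve in a `C`-manifold stays orthogonal to the structure fields `ξ_α` to all orders,
because these fields are parallel: `∇ξ_α = 0`. This is proved in two steps. Since `η^α` is closed,
`∇ξ_α` is a symmetric operator. Since the structure is normal and `Ω`, `η^α` are closed, the flow of
`ξ_α` preserves `φ` and `Ω` and commutes with all the `ξ_β`, hence preserves `g`; so `ξ_α` is a
Killing field and `∇ξ_α` is also skew (`IsFramedPhiForm.killing`). In the chart at a point the
outcome reads `∂_a η(b) = ½ (∂_a g(b, ξ) + ∂_b g(a, ξ) - ∂_ξ g(a, b))`, that is, `∇η = 0`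
(`IsFramedPhiForm.eta_parallel`, `IsCManifold.fderiv_eta_inChart`). The brackets and exterior
derivatives of the hypotheses are computed on coordinate fields of that chart.

It follows that `(η^α(V))' = η^α(∇_{γ'} V)` for every field `V` along a curve
(`IsCManifold.hasDerivWithinAt_eta`). For a Legendre helix, `η^α(T) = 0` and the first Frenet
equation give `η^α(v₂) = 0`; the second one then gives `κ₂ η^α(v₃) = 0`.

Finally `span {T, v₂, v₃}` is an odd-dimensional space on which the skew operator `φ` acts, so `φ`
has a kernel there, and the kernel of `φ` is spanned by the `ξ_α`. Thus `η^α(v₃)` cannot vanish for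
all `α`, which forces `κ₂ = 0`, and `φ` must preserve the plane spanned by `T` and `v₂`
(`IsFramedPhiStructure.phi_of_invariant_span`).
-/

open scoped Topology

noncomputable section

namespace CMfd

/-! ### Linear algebra of the 1-jet of the structure -/

section Algebra

variable {E : Type*} [NormedAddCommGroup E] [NormedSpace ℝ E] {s : ℕ}

/-- The pointwise identities of a framed `φ`-structure, for a bilinear form `G`, an operator `P`,
vectors `x α` and linear forms `h α` on a single vector space. -/
structure IsFramedPhiForm (G : E →L[ℝ] E →L[ℝ] ℝ) (P : E →L[ℝ] E) (x : Fin s → E)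
    (h : Fin s → E →L[ℝ] ℝ) : Prop where
  symm : ∀ a b, G a b = G b a
  phi_sq : ∀ a, P (P a) = -a + ∑ α, h α a • x α
  eta_xi : ∀ α β, h α (x β) = if α = β then 1 else 0
  phi_xi : ∀ α, P (x α) = 0
  eta_phi : ∀ α a, h α (P a) = 0
  eta_eq : ∀ α a, h α a = G a (x α)
  metric_phi : ∀ a b, G (P a) (P b) = G a b - ∑ α, h α a * h α b

namespace IsFramedPhiForm

variable {G : E →L[ℝ] E →L[ℝ] ℝ} {P : E →L[ℝ] E} {x : Fin s → E} {h : Fin s → E →L[ℝ] ℝ}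

lemma phi_skew (H : IsFramedPhiForm G P x h) (a b : E) : G (P a) b = -G a (P b) := by
  have h1 := H.metric_phi a (P b)
  rw [H.phi_sq] at h1
  simp only [map_add, map_neg, map_sum, map_smul, ← H.eta_eq, H.eta_phi, smul_eq_mul, mul_zero,
    Finset.sum_const_zero, add_zero, sub_zero] at h1
  linarith

lemma eq_zero_of_phi_eq_zero (H : IsFramedPhiForm G P x h) {a : E} (ha : P a = 0)
    (ha' : ∀ α, h α a = 0) : a = 0 := by
  have h1 := H.phi_sq a
  simpa [ha, ha'] using h1

variable {DG : E →L[ℝ] E →L[ℝ] E →L[ℝ] ℝ} {DP : E →L[ℝ] E →L[ℝ] E}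
  {Dx : Fin s → E →L[ℝ] E} {Dh : Fin s → E →L[ℝ] E →L[ℝ] ℝ}

/-- Here and below `DG`, `DP`, `Dx`, `Dh` stand for the derivatives of `G`, `P`, `x`, `h` at a
point, the direction of differentiation being the first argument, and the hypotheses are the
derivatives of the pointwise identities together with normality and closedness in coordinates. The
conclusion says that the Lie derivative of `φ` along `ξ_α` vanishes: normality puts its values into
the kernel of `φ`, and closedness of the `η^β` shows that they have no component along the `ξ_β`. -/
lemma phi_invariant_of_normal (H : IsFramedPhiForm G P x h)
    (hηξ : ∀ α β c, Dh α c (x β) + h α (Dx β c) = 0)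
    (hηφ : ∀ α b c, Dh α c (P b) + h α (DP c b) = 0)
    (hsymm : ∀ α a b, Dh α a b = Dh α b a)
    (hN : ∀ α a, P (P (Dx α a)) = P (Dx α (P a) - DP (x α) a)) (α : Fin s) (b : E) :
    Dx α (P b) - DP (x α) b = P (Dx α b) := by
  rw [← sub_eq_zero]
  apply H.eq_zero_of_phi_eq_zero
  · rw [map_sub, hN, sub_self]
  · intro β
    have e1 := hηξ β α (P b)
    have e2 := hηφ β b (x α)
    have e3 := hsymm β (P b) (x α)
    rw [map_sub, map_sub, H.eta_phi]
    linarith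

/-- The fields `ξ_α` commute: normality gives `φ² [ξ_α, ξ_β] = 0`, and closedness of the forms gives
`η^γ([ξ_α, ξ_β]) = 0`. -/
lemma xi_commute_of_normal (H : IsFramedPhiForm G P x h)
    (hηξ : ∀ α β c, Dh α c (x β) + h α (Dx β c) = 0)
    (hφξ : ∀ α c, DP c (x α) + P (Dx α c) = 0)
    (hsymm : ∀ α a b, Dh α a b = Dh α b a)
    (hN : ∀ α a, P (P (Dx α a)) = P (Dx α (P a) - DP (x α) a)) (α β : Fin s) :
    Dx α (x β) = Dx β (x α) := by
  rw [← sub_eq_zero]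
  have hφ : P (P (Dx α (x β) - Dx β (x α))) = 0 := by
    have e1 := hφξ β (x α)
    rw [map_sub, map_sub, hN, H.phi_xi, map_zero, zero_sub, map_neg, ← map_neg,
      ← eq_neg_of_add_eq_zero_right e1, sub_self]
  have hη : ∀ δ, h δ (Dx α (x β) - Dx β (x α)) = 0 := by
    intro δ
    have e1 := hηξ δ α (x β)
    have e2 := hηξ δ β (x α)
    have e3 := hsymm δ (x α) (x β)
    rw [map_sub]
    linarith
  have h1 := H.phi_sq (Dx α (x β) - Dx β (x α))
  rw [hφ] at h1
  rw [← neg_eq_zero]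
  simpa [hη] using h1.symm

/-- The fields `ξ_α` are Killing: the Lie derivative of `G` along `ξ_α` vanishes. -/
lemma killing (H : IsFramedPhiForm G P x h)
    (hη : ∀ α a c, Dh α c a = DG c a (x α) + G a (Dx α c))
    (hηξ : ∀ α β c, Dh α c (x β) + h α (Dx β c) = 0)
    (hφξ : ∀ α c, DP c (x α) + P (Dx α c) = 0)
    (hηφ : ∀ α b c, Dh α c (P b) + h α (DP c b) = 0)
    (hsymm : ∀ α a b, Dh α a b = Dh α b a)
    (hN : ∀ α a, P (P (Dx α a)) = P (Dx α (P a) - DP (x α) a))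
    (hΩ : ∀ α a b, DG (x α) a (P b) + G a (DP (x α) b) - G (Dx α b) (P a)
      + G (Dx α a) (P b) = 0) (α : Fin s) (a b : E) :
    DG (x α) a b + G (Dx α a) b + G a (Dx α b) = 0 := by
  have hP : ∀ b, DG (x α) a (P b) + G (Dx α a) (P b) + G a (Dx α (P b)) = 0 := by
    intro b
    have e1 := hΩ α a b
    have e2 : Dx α (P b) = P (Dx α b) + DP (x α) b := by
      rw [← H.phi_invariant_of_normal hηξ hηφ hsymm hN α b]; abel
    have e3 := H.phi_skew a (Dx α b)
    have e4 := H.symm (Dx α b) (P a)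
    rw [e2, map_add]
    linarith
  have hX : ∀ β, DG (x α) a (x β) + G (Dx α a) (x β) + G a (Dx α (x β)) = 0 := by
    intro β
    have e1 := hη β a (x α)
    have e2 := hηξ β α a
    have e3 := hsymm β a (x α)
    rw [H.xi_commute_of_normal hηξ hφξ hsymm hN, ← H.eta_eq]
    linarith
  -- `E` is spanned by the image of `φ` and the `ξ_β`, so it suffices to take `b` there.
  let K : E →L[ℝ] ℝ := DG (x α) a + G (Dx α a) + (G a).comp (Dx α)
  have hKP : ∀ b, K (P b) = 0 := hP
  have hKX : ∀ β, K (x β) = 0 := hX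
  have hb : b = -P (P b) + ∑ β, h β b • x β := by rw [H.phi_sq]; abel
  change K b = 0
  rw [hb]
  simp [hKP, hKX]

/-- The forms `η^α` are parallel: their coordinate derivatives are given by the Christoffel symbols
of the first kind. This combines the Killing equation with the symmetry of `Dh α`. -/
lemma eta_parallel (H : IsFramedPhiForm G P x h)
    (hη : ∀ α a c, Dh α c a = DG c a (x α) + G a (Dx α c))
    (hηξ : ∀ α β c, Dh α c (x β) + h α (Dx β c) = 0)
    (hφξ : ∀ α c, DP c (x α) + P (Dx α c) = 0)
    (hηφ : ∀ α b c, Dh α c (P b) + h α (DP c b) = 0)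
    (hsymm : ∀ α a b, Dh α a b = Dh α b a)
    (hN : ∀ α a, P (P (Dx α a)) = P (Dx α (P a) - DP (x α) a))
    (hΩ : ∀ α a b, DG (x α) a (P b) + G a (DP (x α) b) - G (Dx α b) (P a)
      + G (Dx α a) (P b) = 0) (α : Fin s) (a b : E) :
    Dh α a b = 1 / 2 * (DG a b (x α) + DG b a (x α) - DG (x α) a b) := by
  have e1 := H.killing hη hηξ hφξ hηφ hsymm hN hΩ α a b
  have e2 := hη α a b
  have e3 := hη α b a
  have e4 := hsymm α a b
  have e5 := H.symm (Dx α a) b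
  linarith

end IsFramedPhiForm

end Algebra

/-! ### Vector fields in a chart -/

section Chart

variable {E : Type*} [NormedAddCommGroup E] [NormedSpace ℝ E]
  {M : Type*} [TopologicalSpace M] [ChartedSpace E M] [IsManifold 𝓘(ℝ, E) ∞ M]

/-- The isomorphism from the tangent space at `z` to the model space `E` given by the chart at `x₀`
(meaningful for `z` in the domain of that chart). -/
def toChart (x₀ z : M) : TangentSpace 𝓘(ℝ, E) z →L[ℝ] E :=
  (trivializationAt E (TangentSpace 𝓘(ℝ, E) : M → Type _) x₀).continuousLinearMapAt ℝ z

/-- The inverse of `toChart`: the tangent vector at `z` with given coordinates in the chart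
at `x₀`. -/
def ofChart (x₀ z : M) : E →L[ℝ] TangentSpace 𝓘(ℝ, E) z :=
  (trivializationAt E (TangentSpace 𝓘(ℝ, E) : M → Type _) x₀).symmL ℝ z

lemma toChart_ofChart {x₀ z : M} (hz : z ∈ (chartAt E x₀).source) (a : E) :
    toChart x₀ z (ofChart x₀ z a) = a :=
  (trivializationAt E (TangentSpace 𝓘(ℝ, E) : M → Type _) x₀).continuousLinearMapAt_symmL
    (R := ℝ) hz a

lemma ofChart_toChart {x₀ z : M} (hz : z ∈ (chartAt E x₀).source) (v : TangentSpace 𝓘(ℝ, E) z) :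
    ofChart x₀ z (toChart x₀ z v) = v :=
  (trivializationAt E (TangentSpace 𝓘(ℝ, E) : M → Type _) x₀).symmL_continuousLinearMapAt
    (R := ℝ) hz v

/-- At the base point of the chart, Mathlib identifies the tangent space with `E` definitionally. -/
lemma ofChart_self (x₀ : M) (a : E) : ofChart x₀ x₀ a = (a : E) := by
  have h := TangentBundle.symmL_trivializationAt_eq_core (I := 𝓘(ℝ, E)) (mem_chart_source E x₀)
  have h2 := (tangentBundleCore 𝓘(ℝ, E) M).coordChange_self (achart E x₀) x₀
    (mem_chart_source E x₀) a
  exact (DFunLike.congr_fun h a).trans h2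

lemma toChart_self (x₀ : M) (v : TangentSpace 𝓘(ℝ, E) x₀) : toChart x₀ x₀ v = (v : E) := by
  have h := TangentBundle.continuousLinearMapAt_trivializationAt_eq_core (I := 𝓘(ℝ, E))
    (mem_chart_source E x₀)
  have h2 := (tangentBundleCore 𝓘(ℝ, E) M).coordChange_self (achart E x₀) x₀
    (mem_chart_source E x₀) v
  exact (DFunLike.congr_fun h v).trans h2

lemma trivializationAt_snd_eq_toChart {x₀ z : M} (hz : z ∈ (chartAt E x₀).source)
    (v : TangentSpace 𝓘(ℝ, E) z) :
    (trivializationAt E (TangentSpace 𝓘(ℝ, E) : M → Type _) x₀ ⟨z, v⟩).2 = toChart x₀ z v := by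
  have := (trivializationAt E (TangentSpace 𝓘(ℝ, E) : M → Type _) x₀).coe_linearMapAt_of_mem
    (R := ℝ) (b := z) hz
  exact (congrFun this v).symm

/-- The vector field `V` read in the chart at `x₀`. -/
def fieldInChart (x₀ : M) (V : ∀ z : M, TangentSpace 𝓘(ℝ, E) z) (y : E) : E :=
  toChart x₀ ((extChartAt 𝓘(ℝ, E) x₀).symm y) (V ((extChartAt 𝓘(ℝ, E) x₀).symm y))

/-- The (1,1)-tensor field `φ` read in the chart at `x₀`. -/
def endoInChart (x₀ : M) (φ : ∀ z : M, TangentSpace 𝓘(ℝ, E) z →L[ℝ] TangentSpace 𝓘(ℝ, E) z)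
    (y : E) : E →L[ℝ] E :=
  (toChart x₀ ((extChartAt 𝓘(ℝ, E) x₀).symm y)).comp
    ((φ ((extChartAt 𝓘(ℝ, E) x₀).symm y)).comp (ofChart x₀ ((extChartAt 𝓘(ℝ, E) x₀).symm y)))

/-- The 1-form `η` read in the chart at `x₀`. -/
def formInChart (x₀ : M) (η : ∀ z : M, TangentSpace 𝓘(ℝ, E) z →L[ℝ] ℝ) (y : E) : E →L[ℝ] ℝ :=
  (η ((extChartAt 𝓘(ℝ, E) x₀).symm y)).comp (ofChart x₀ ((extChartAt 𝓘(ℝ, E) x₀).symm y))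

omit [IsManifold 𝓘(ℝ, E) ∞ M] in
lemma eventually_mem_source (x₀ : M) :
    ∀ᶠ y in 𝓝 (extChartAt 𝓘(ℝ, E) x₀ x₀),
      (extChartAt 𝓘(ℝ, E) x₀).symm y ∈ (chartAt E x₀).source := by
  filter_upwards [extChartAt_target_mem_nhds (I := 𝓘(ℝ, E)) x₀] with y hy
  rw [← extChartAt_source 𝓘(ℝ, E)]
  exact (extChartAt 𝓘(ℝ, E) x₀).map_target hy

lemma fieldInChart_self (x₀ : M) (V : ∀ z : M, TangentSpace 𝓘(ℝ, E) z) :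
    fieldInChart x₀ V (extChartAt 𝓘(ℝ, E) x₀ x₀) = toChart x₀ x₀ (V x₀) := by
  rw [fieldInChart, extChartAt_to_inv]

/-- The directional derivative in coordinates. Differentiability of the coordinate expression `F`
ensures that `mfderiv` does not take its default value. -/
lemma dirDeriv_eq_fderiv {x₀ : M} (X : ∀ z : M, TangentSpace 𝓘(ℝ, E) z) {f : M → ℝ} {F : E → ℝ}
    (hF : DifferentiableAt ℝ F (extChartAt 𝓘(ℝ, E) x₀ x₀))
    (hf : ∀ᶠ y in 𝓝 (extChartAt 𝓘(ℝ, E) x₀ x₀), f ((extChartAt 𝓘(ℝ, E) x₀).symm y) = F y) :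
    dirDeriv X f x₀ = fderiv ℝ F (extChartAt 𝓘(ℝ, E) x₀ x₀)
      (fieldInChart x₀ X (extChartAt 𝓘(ℝ, E) x₀ x₀)) := by
  have hc : ContinuousAt (extChartAt 𝓘(ℝ, E) x₀) x₀ := continuousAt_extChartAt x₀
  have hfF : f =ᶠ[𝓝 x₀] F ∘ extChartAt 𝓘(ℝ, E) x₀ := by
    filter_upwards [hc.eventually hf, extChartAt_source_mem_nhds (I := 𝓘(ℝ, E)) x₀] with z hz hz'
    rw [Function.comp_apply, ← hz, (extChartAt 𝓘(ℝ, E) x₀).left_inv hz']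
  have hd : MDifferentiableAt 𝓘(ℝ, E) 𝓘(ℝ, ℝ) f x₀ :=
    (hF.mdifferentiableAt.comp x₀ (mdifferentiableAt_extChartAt
      (mem_chart_source E x₀))).congr_of_eventuallyEq hfF
  rw [dirDeriv, hd.mfderiv]
  have : writtenInExtChartAt 𝓘(ℝ, E) 𝓘(ℝ, ℝ) x₀ f =ᶠ[𝓝 (extChartAt 𝓘(ℝ, E) x₀ x₀)] F := by
    filter_upwards [hf] with y hy
    rw [writtenInExtChartAt, extChartAt_model_space_eq_id]
    exact hy
  simp only [ModelWithCorners.range_eq_univ, fderivWithin_univ]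
  rw [this.fderiv_eq, fieldInChart_self, toChart_self]
  rfl

/-- The Lie bracket at the base point of a chart, in coordinates. The fields need to agree with
their coordinate expressions `A`, `B` only near that point. -/
lemma mlieBracket_eq_fderiv [CompleteSpace E] {x₀ : M} {X Y : ∀ z : M, TangentSpace 𝓘(ℝ, E) z}
    {A B : E → E}
    (hA : fieldInChart x₀ X =ᶠ[𝓝 (extChartAt 𝓘(ℝ, E) x₀ x₀)] A)
    (hB : fieldInChart x₀ Y =ᶠ[𝓝 (extChartAt 𝓘(ℝ, E) x₀ x₀)] B) :
    mlieBracket 𝓘(ℝ, E) X Y x₀ = ofChart x₀ x₀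
      (fderiv ℝ B (extChartAt 𝓘(ℝ, E) x₀ x₀) (A (extChartAt 𝓘(ℝ, E) x₀ x₀)) -
        fderiv ℝ A (extChartAt 𝓘(ℝ, E) x₀ x₀) (B (extChartAt 𝓘(ℝ, E) x₀ x₀))) := by
  -- The pullback by the inverse chart in the definition of the bracket is the reading in the chart.
  have key : ∀ V : ∀ z : M, TangentSpace 𝓘(ℝ, E) z,
      mpullbackWithin 𝓘(ℝ, E) 𝓘(ℝ, E) (extChartAt 𝓘(ℝ, E) x₀).symm V (range 𝓘(ℝ, E))
        =ᶠ[𝓝 (extChartAt 𝓘(ℝ, E) x₀ x₀)] fieldInChart x₀ V := by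
    intro V
    filter_upwards [extChartAt_target_mem_nhds (I := 𝓘(ℝ, E)) x₀, eventually_mem_source x₀]
      with y hy hy'
    have h1 := TangentBundle.symmL_trivializationAt (I := 𝓘(ℝ, E)) hy'
    rw [(extChartAt 𝓘(ℝ, E) x₀).right_inv hy] at h1
    refine (isInvertible_mfderivWithin_extChartAt_symm hy).inverse_apply_eq.2 ?_
    rw [← h1]
    exact (ofChart_toChart hy' _).symm
  have hAX := (key X).trans hA
  have hBY := (key Y).trans hB
  have hbr : mlieBracket 𝓘(ℝ, E) X Y x₀ =
      (mfderiv 𝓘(ℝ, E) 𝓘(ℝ, E) (extChartAt 𝓘(ℝ, E) x₀) x₀).inverse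
        (lieBracket ℝ A B (extChartAt 𝓘(ℝ, E) x₀ x₀) : E) := by
    rw [← mlieBracketWithin_univ, mlieBracketWithin_apply]
    congr 1
    have hset : (extChartAt 𝓘(ℝ, E) x₀).symm ⁻¹' univ ∩ range 𝓘(ℝ, E) = univ := by simp
    refine (congrArg (fun S => lieBracketWithin ℝ (E := E) _ _ S _) hset).trans ?_
    exact (congrFun lieBracketWithin_univ _).trans (hAX.lieBracket_vectorField_eq hBY)
  rw [hbr]
  refine (isInvertible_mfderiv_extChartAt (mem_extChartAt_source x₀)).inverse_apply_eq.2 ?_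
  rw [← TangentBundle.continuousLinearMapAt_trivializationAt (mem_chart_source E x₀)]
  exact (toChart_ofChart (mem_chart_source E x₀) _).symm

end Chart

/-! ### The structure tensors in a chart -/

section Smooth

variable {E : Type*} [NormedAddCommGroup E] [NormedSpace ℝ E]
  {M : Type*} [TopologicalSpace M] [ChartedSpace E M] [IsManifold 𝓘(ℝ, E) ∞ M]

lemma differentiableAt_comp_extChartAt_symm {F : Type*} [NormedAddCommGroup F] [NormedSpace ℝ F]
    {x₀ : M} {f : M → F} (hf : ContMDiffAt 𝓘(ℝ, E) 𝓘(ℝ, F) ∞ f x₀) :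
    DifferentiableAt ℝ (fun y => f ((extChartAt 𝓘(ℝ, E) x₀).symm y))
      (extChartAt 𝓘(ℝ, E) x₀ x₀) := by
  have h1 := hf.mdifferentiableAt (by simp)
  have h2 : MDifferentiableAt 𝓘(ℝ, E) 𝓘(ℝ, E) (extChartAt 𝓘(ℝ, E) x₀).symm
      (extChartAt 𝓘(ℝ, E) x₀ x₀) := by
    have := mdifferentiableWithinAt_extChartAt_symm (I := 𝓘(ℝ, E))
      (mem_extChartAt_target (I := 𝓘(ℝ, E)) x₀)
    rwa [ModelWithCorners.range_eq_univ, mdifferentiableWithinAt_univ] at this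
  rw [← extChartAt_to_inv (I := 𝓘(ℝ, E)) x₀] at h1
  exact (h1.comp _ h2).differentiableAt

lemma differentiableAt_fieldInChart {x₀ : M} {V : ∀ z : M, TangentSpace 𝓘(ℝ, E) z}
    (hV : SmoothFieldOn V univ) :
    DifferentiableAt ℝ (fieldInChart x₀ V) (extChartAt 𝓘(ℝ, E) x₀ x₀) := by
  have h1 := ((trivializationAt E (TangentSpace 𝓘(ℝ, E) : M → Type _) x₀).contMDiffAt_section_iff
    (IB := 𝓘(ℝ, E)) (n := ∞) (s := V) (mem_chart_source E x₀)).1 (hV.contMDiffAt Filter.univ_mem)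
  refine (differentiableAt_comp_extChartAt_symm h1).congr_of_eventuallyEq ?_
  filter_upwards [eventually_mem_source x₀] with y hy
  exact (trivializationAt_snd_eq_toChart hy _).symm

lemma differentiableAt_endoInChart {x₀ : M}
    {φ : ∀ x : M, TangentSpace 𝓘(ℝ, E) x →L[ℝ] TangentSpace 𝓘(ℝ, E) x}
    (hφ : ContMDiff 𝓘(ℝ, E) (𝓘(ℝ, E).prod 𝓘(ℝ, E →L[ℝ] E)) ∞
      (fun x => TotalSpace.mk' (E →L[ℝ] E)
        (E := fun x : M => TangentSpace 𝓘(ℝ, E) x →L[ℝ] TangentSpace 𝓘(ℝ, E) x) x (φ x))) :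
    DifferentiableAt ℝ (endoInChart x₀ φ) (extChartAt 𝓘(ℝ, E) x₀ x₀) :=
  differentiableAt_comp_extChartAt_symm ((contMDiffAt_hom_bundle _).1 (hφ x₀)).2

lemma differentiableAt_formInChart {x₀ : M}
    {η : ∀ x : M, TangentSpace 𝓘(ℝ, E) x →L[ℝ] ℝ}
    (hη : ContMDiff 𝓘(ℝ, E) (𝓘(ℝ, E).prod 𝓘(ℝ, E →L[ℝ] ℝ)) ∞
      (fun x => TotalSpace.mk' (E →L[ℝ] ℝ)
        (E := fun x : M => TangentSpace 𝓘(ℝ, E) x →L[ℝ] ℝ) x (η x))) :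
    DifferentiableAt ℝ (formInChart x₀ η) (extChartAt 𝓘(ℝ, E) x₀ x₀) := by
  refine (differentiableAt_comp_extChartAt_symm
    ((contMDiffAt_hom_bundle _).1 (hη x₀)).2).congr_of_eventuallyEq ?_
  filter_upwards [eventually_mem_source x₀] with y hy
  ext a
  simp [ContinuousLinearMap.inCoordinates]
  rfl

lemma differentiableAt_metricInChart (g : Metric E M) (x₀ : M) :
    DifferentiableAt ℝ (metricInChart g x₀) (extChartAt 𝓘(ℝ, E) x₀ x₀) := by
  refine (differentiableAt_comp_extChartAt_symm
    ((contMDiffAt_hom_bundle _).1 (g.contMDiff x₀)).2).congr_of_eventuallyEq ?_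
  filter_upwards [eventually_mem_source x₀] with y hy
  ext a b
  -- The trivialization of the cotangent bundle is precomposition with that of the tangent bundle.
  have hbase : (extChartAt 𝓘(ℝ, E) x₀).symm y ∈ (trivializationAt (E →L[ℝ] ℝ)
      (fun z : M => TangentSpace 𝓘(ℝ, E) z →L[ℝ] ℝ) x₀).baseSet := ⟨hy, mem_univ _⟩
  simp only [ContinuousLinearMap.inCoordinates, ContinuousLinearMap.comp_apply,
    Trivialization.continuousLinearMapAt_apply, Trivialization.coe_linearMapAt_of_mem _ hbase,
    hom_trivializationAt_apply]
  exact (congrFun (Trivialization.coe_linearMapAt_of_mem (R := ℝ)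
    (trivializationAt ℝ (Bundle.Trivial M ℝ) x₀) (mem_univ _)) _).symm

/-- The vector field with constant coordinates `a` in the chart at `x₀`. -/
def coordField (x₀ : M) (a : E) (z : M) : TangentSpace 𝓘(ℝ, E) z := ofChart x₀ z a

lemma smoothFieldOn_coordField (x₀ : M) (a : E) :
    SmoothFieldOn (coordField x₀ a) (chartAt E x₀).source := by
  refine ((trivializationAt E (TangentSpace 𝓘(ℝ, E) : M → Type _)
    x₀).contMDiffOn_section_baseSet_iff (IB := 𝓘(ℝ, E)) (n := ∞) (s := coordField x₀ a)).2 ?_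
  refine (contMDiffOn_const (c := a)).congr fun z hz => ?_
  rw [trivializationAt_snd_eq_toChart hz, coordField, toChart_ofChart hz]

lemma fieldInChart_coordField (x₀ : M) (a : E) :
    fieldInChart x₀ (coordField x₀ a) =ᶠ[𝓝 (extChartAt 𝓘(ℝ, E) x₀ x₀)] fun _ => a := by
  filter_upwards [eventually_mem_source x₀] with y hy
  exact toChart_ofChart hy a

lemma metricInChart_apply (g : Metric E M) (x₀ : M) (y a b : E) :
    metricInChart g x₀ y a b = g.inner ((extChartAt 𝓘(ℝ, E) x₀).symm y)
      (ofChart x₀ ((extChartAt 𝓘(ℝ, E) x₀).symm y) a)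
      (ofChart x₀ ((extChartAt 𝓘(ℝ, E) x₀).symm y) b) := rfl

lemma endoInChart_apply (x₀ : M)
    (φ : ∀ z : M, TangentSpace 𝓘(ℝ, E) z →L[ℝ] TangentSpace 𝓘(ℝ, E) z) (y a : E) :
    endoInChart x₀ φ y a = toChart x₀ ((extChartAt 𝓘(ℝ, E) x₀).symm y)
      (φ ((extChartAt 𝓘(ℝ, E) x₀).symm y) (ofChart x₀ ((extChartAt 𝓘(ℝ, E) x₀).symm y) a)) := rfl

lemma formInChart_apply (x₀ : M) (η : ∀ z : M, TangentSpace 𝓘(ℝ, E) z →L[ℝ] ℝ) (y a : E) :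
    formInChart x₀ η y a = η ((extChartAt 𝓘(ℝ, E) x₀).symm y)
      (ofChart x₀ ((extChartAt 𝓘(ℝ, E) x₀).symm y) a) := rfl

/-- In the domain of a chart, the components of a framed `φ`-structure satisfy its identities. -/
lemma isFramedPhiForm_inChart {s : ℕ} {g : Metric E M}
    {φ : ∀ x : M, TangentSpace 𝓘(ℝ, E) x →L[ℝ] TangentSpace 𝓘(ℝ, E) x}
    {ξ : Fin s → ∀ x : M, TangentSpace 𝓘(ℝ, E) x}
    {η : Fin s → ∀ x : M, TangentSpace 𝓘(ℝ, E) x →L[ℝ] ℝ}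
    (hM : IsFramedPhiStructure g φ ξ η) {x₀ : M} {y : E}
    (hy : (extChartAt 𝓘(ℝ, E) x₀).symm y ∈ (chartAt E x₀).source) :
    IsFramedPhiForm (metricInChart g x₀ y) (endoInChart x₀ φ y) (fun α => fieldInChart x₀ (ξ α) y)
      (fun α => formInChart x₀ (η α) y) where
  symm a b := by
    rw [metricInChart_apply, metricInChart_apply]
    exact g.symm _ _ _
  phi_sq a := by
    rw [endoInChart_apply, endoInChart_apply, ofChart_toChart hy, hM.phi_sq, map_add, map_neg,
      map_sum, toChart_ofChart hy]
    simp only [map_smul]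
    rfl
  eta_xi α β := by
    rw [formInChart_apply, fieldInChart, ofChart_toChart hy]
    exact hM.eta_xi α β _
  phi_xi α := by
    rw [endoInChart_apply, fieldInChart, ofChart_toChart hy, hM.phi_xi, map_zero]
  eta_phi α a := by
    rw [formInChart_apply, endoInChart_apply, ofChart_toChart hy]
    exact hM.eta_phi _ _ _
  eta_eq α a := by
    rw [formInChart_apply, metricInChart_apply, fieldInChart, ofChart_toChart hy]
    exact hM.eta_eq α _ _
  metric_phi a b := by
    simp only [metricInChart_apply, endoInChart_apply, formInChart_apply, ofChart_toChart hy]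
    exact hM.metric_phi _ _ _

end Smooth

/-! ### The forms `η^α` are parallel -/

section Parallel

variable {E : Type*} [NormedAddCommGroup E] [NormedSpace ℝ E]
  {M : Type*} [TopologicalSpace M] [ChartedSpace E M] [IsManifold 𝓘(ℝ, E) ∞ M]

lemma metricInChart_self (g : Metric E M) (x₀ : M) (a b : E) :
    g.inner x₀ (ofChart x₀ x₀ a) (ofChart x₀ x₀ b) =
      metricInChart g x₀ (extChartAt 𝓘(ℝ, E) x₀ x₀) a b := by
  rw [metricInChart_apply, extChartAt_to_inv]

lemma formInChart_self (x₀ : M) (η : ∀ z : M, TangentSpace 𝓘(ℝ, E) z →L[ℝ] ℝ) (a : E) :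
    η x₀ (ofChart x₀ x₀ a) = formInChart x₀ η (extChartAt 𝓘(ℝ, E) x₀ x₀) a := by
  rw [formInChart_apply, extChartAt_to_inv]

lemma endoInChart_self (x₀ : M)
    (φ : ∀ z : M, TangentSpace 𝓘(ℝ, E) z →L[ℝ] TangentSpace 𝓘(ℝ, E) z) (a : E) :
    φ x₀ (ofChart x₀ x₀ a) =
      ofChart x₀ x₀ (endoInChart x₀ φ (extChartAt 𝓘(ℝ, E) x₀ x₀) a) := by
  rw [endoInChart_apply, extChartAt_to_inv, ofChart_toChart (mem_chart_source E x₀)]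

lemma christoffelForm_apply (g : Metric E M) (x₀ : M) (u v w : TangentSpace 𝓘(ℝ, E) x₀) :
    christoffelForm g x₀ u v w = 1 / 2 *
      (fderiv ℝ (metricInChart g x₀) (extChartAt 𝓘(ℝ, E) x₀ x₀)
          (toChart x₀ x₀ u) (toChart x₀ x₀ v) (toChart x₀ x₀ w)
        + fderiv ℝ (metricInChart g x₀) (extChartAt 𝓘(ℝ, E) x₀ x₀)
          (toChart x₀ x₀ v) (toChart x₀ x₀ u) (toChart x₀ x₀ w)
        - fderiv ℝ (metricInChart g x₀) (extChartAt 𝓘(ℝ, E) x₀ x₀)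
          (toChart x₀ x₀ w) (toChart x₀ x₀ u) (toChart x₀ x₀ v)) := by
  simp only [toChart_self]
  rfl

lemma fderiv_clm_apply_apply {F F' F'' : Type*} [NormedAddCommGroup F] [NormedSpace ℝ F]
    [NormedAddCommGroup F'] [NormedSpace ℝ F'] [NormedAddCommGroup F''] [NormedSpace ℝ F'']
    {T : F → F' →L[ℝ] F''} {u : F → F'} {y : F} (hT : DifferentiableAt ℝ T y)
    (hu : DifferentiableAt ℝ u y) (c : F) :
    fderiv ℝ (fun z => T z (u z)) y c = fderiv ℝ T y c (u y) + T y (fderiv ℝ u y c) := by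
  rw [fderiv_clm_apply hT hu]
  simp [add_comm]

lemma fderiv_clm_apply_const {F F' F'' : Type*} [NormedAddCommGroup F] [NormedSpace ℝ F]
    [NormedAddCommGroup F'] [NormedSpace ℝ F'] [NormedAddCommGroup F''] [NormedSpace ℝ F'']
    {T : F → F' →L[ℝ] F''} {y : F} (hT : DifferentiableAt ℝ T y) (a : F') (c : F) :
    fderiv ℝ (fun z => T z a) y c = fderiv ℝ T y c a := by
  rw [fderiv_clm_apply_apply hT (differentiableAt_const a)]
  simp

/-- Closedness of a 1-form means that its coordinate derivative is symmetric: test it on coordinate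
fields, whose bracket vanishes. -/
lemma fderiv_formInChart_symm [CompleteSpace E]
    {η : ∀ x : M, TangentSpace 𝓘(ℝ, E) x →L[ℝ] ℝ} {x₀ : M}
    (hη : DifferentiableAt ℝ (formInChart x₀ η) (extChartAt 𝓘(ℝ, E) x₀ x₀))
    (hclosed : ∀ (U : Set M) (X Y : ∀ x : M, TangentSpace 𝓘(ℝ, E) x), IsOpen U →
      SmoothFieldOn X U → SmoothFieldOn Y U → ∀ x ∈ U, extDerivOne η X Y x = 0) (a b : E) :
    fderiv ℝ (formInChart x₀ η) (extChartAt 𝓘(ℝ, E) x₀ x₀) a b =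
      fderiv ℝ (formInChart x₀ η) (extChartAt 𝓘(ℝ, E) x₀ x₀) b a := by
  have h := hclosed _ _ _ (chartAt E x₀).open_source (smoothFieldOn_coordField x₀ a)
    (smoothFieldOn_coordField x₀ b) x₀ (mem_chart_source E x₀)
  have hd : ∀ c d : E, dirDeriv (coordField x₀ c) (fun y => η y (coordField x₀ d y)) x₀ =
      fderiv ℝ (formInChart x₀ η) (extChartAt 𝓘(ℝ, E) x₀ x₀) c d := by
    intro c d
    rw [dirDeriv_eq_fderiv (F := fun y => formInChart x₀ η y d) _
      (hη.clm_apply (differentiableAt_const d)) (Filter.Eventually.of_forall fun y => rfl)]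
    rw [fderiv_clm_apply_const hη, (fieldInChart_coordField x₀ c).self_of_nhds]
  rw [extDerivOne, hd, hd, mlieBracket_eq_fderiv (fieldInChart_coordField x₀ a)
    (fieldInChart_coordField x₀ b)] at h
  simp only [fderiv_fun_const, Pi.zero_apply, zero_apply, sub_self, map_zero] at h
  linarith

variable {s : ℕ} {g : Metric E M}
  {φ : ∀ x : M, TangentSpace 𝓘(ℝ, E) x →L[ℝ] TangentSpace 𝓘(ℝ, E) x}
  {ξ : Fin s → ∀ x : M, TangentSpace 𝓘(ℝ, E) x}
  {η : Fin s → ∀ x : M, TangentSpace 𝓘(ℝ, E) x →L[ℝ] ℝ}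

/-- Normality in coordinates, tested on a coordinate field and `ξ_α`, where `dη^β` vanishes. -/
lemma IsCManifold.normal_inChart [CompleteSpace E] (hM : IsCManifold g φ ξ η) (x₀ : M)
    (α : Fin s) (a : E) :
    let p := extChartAt 𝓘(ℝ, E) x₀ x₀
    let P := endoInChart x₀ φ
    let X := fieldInChart x₀ (ξ α)
    P p (P p (fderiv ℝ X p a)) = P p (fderiv ℝ X p (P p a) - fderiv ℝ P p (X p) a) := by
  intro p P X
  have hP : DifferentiableAt ℝ P p := differentiableAt_endoInChart hM.smooth_phi
  have hξs : SmoothFieldOn (ξ α) (chartAt E x₀).source := (hM.smooth_xi α).mono (subset_univ _)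
  have h := hM.normal _ _ _ (chartAt E x₀).open_source (smoothFieldOn_coordField x₀ a)
    hξs x₀ (mem_chart_source E x₀)
  have h0 : ∀ β, extDerivOne (η β) (coordField x₀ a) (ξ α) x₀ = 0 := fun β =>
    hM.closed_eta β _ _ _ (chartAt E x₀).open_source (smoothFieldOn_coordField x₀ a)
      hξs x₀ (mem_chart_source E x₀)
  have hφa : fieldInChart x₀ (fun z => φ z (coordField x₀ a z)) =ᶠ[𝓝 p] fun y => P y a :=
    Filter.Eventually.of_forall fun y => rfl
  have hφξ : (fun z => φ z (ξ α z)) = fun z => (0 : TangentSpace 𝓘(ℝ, E) z) :=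
    funext fun z => hM.phi_xi α z
  have hzero : fieldInChart x₀ (fun z => (0 : TangentSpace 𝓘(ℝ, E) z)) =ᶠ[𝓝 p] fun _ => (0 : E) :=
    Filter.Eventually.of_forall fun y => map_zero _
  simp only [nijenhuis, h0, zero_smul, Finset.sum_const_zero, smul_zero, hφξ] at h
  rw [mlieBracket_eq_fderiv (fieldInChart_coordField x₀ a) (Filter.EventuallyEq.refl _ X),
    mlieBracket_eq_fderiv hφa hzero, mlieBracket_eq_fderiv hφa (Filter.EventuallyEq.refl _ X),
    mlieBracket_eq_fderiv (fieldInChart_coordField x₀ a) hzero] at h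
  simp only [endoInChart_self, ← map_add, ← map_sub] at h
  have h' := congrArg (toChart x₀ x₀) h
  rw [toChart_ofChart (mem_chart_source E x₀)] at h'
  change P p (P p (fderiv ℝ X p a - _)) + _ - P p (fderiv ℝ X p (P p a) - _) - _ = _ at h'
  simp only [fderiv_fun_const, Pi.zero_apply, zero_apply, sub_self, map_zero, sub_zero,
    add_zero] at h'
  rw [← fderiv_clm_apply_const hP]
  exact sub_eq_zero.1 h'

/-- Closedness of `Ω` in coordinates, tested on two coordinate fields and `ξ_α`. The terms in which
`ξ_α` is an argument of `Ω` vanish identically, because `φ ξ_α = 0`. -/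
lemma IsCManifold.closed_omega_inChart [CompleteSpace E] (hM : IsCManifold g φ ξ η) (x₀ : M)
    (α : Fin s) (a b : E) :
    let p := extChartAt 𝓘(ℝ, E) x₀ x₀
    let G := metricInChart g x₀
    let P := endoInChart x₀ φ
    let X := fieldInChart x₀ (ξ α)
    fderiv ℝ G p (X p) a (P p b) + G p a (fderiv ℝ P p (X p) b) - G p (fderiv ℝ X p b) (P p a)
      + G p (fderiv ℝ X p a) (P p b) = 0 := by
  intro p G P X
  have hP : DifferentiableAt ℝ P p := differentiableAt_endoInChart hM.smooth_phi
  have hG : DifferentiableAt ℝ G p := differentiableAt_metricInChart g x₀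
  have hξs : SmoothFieldOn (ξ α) (chartAt E x₀).source := (hM.smooth_xi α).mono (subset_univ _)
  have h := hM.closed_omega _ _ _ _ (chartAt E x₀).open_source (smoothFieldOn_coordField x₀ a)
    (smoothFieldOn_coordField x₀ b) hξs x₀ (mem_chart_source E x₀)
  have e1 : (fun y => g.inner y (coordField x₀ b y) (φ y (ξ α y))) = fun _ => 0 := by
    funext y
    rw [hM.phi_xi, map_zero]
  have e2 : (fun y => g.inner y (ξ α y) (φ y (coordField x₀ a y))) = fun _ => 0 := by
    funext y
    rw [g.symm, ← hM.eta_eq, hM.eta_phi]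
  have hd0 : ∀ V : ∀ z : M, TangentSpace 𝓘(ℝ, E) z, dirDeriv V (fun _ => (0 : ℝ)) x₀ = 0 := by
    intro V
    rw [dirDeriv_eq_fderiv (F := fun _ => 0) _ (differentiableAt_const _)
      (Filter.Eventually.of_forall fun y => rfl), fderiv_fun_const]
    rfl
  have hGa : DifferentiableAt ℝ (fun y => G y a) p := hG.clm_apply (differentiableAt_const a)
  have hPb : DifferentiableAt ℝ (fun y => P y b) p := hP.clm_apply (differentiableAt_const b)
  have e3 : dirDeriv (ξ α) (fun y => g.inner y (coordField x₀ a y) (φ y (coordField x₀ b y))) x₀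
      = fderiv ℝ G p (X p) a (P p b) + G p a (fderiv ℝ P p (X p) b) := by
    rw [dirDeriv_eq_fderiv (F := fun y => G y a (P y b)) _ (hGa.clm_apply hPb),
      fderiv_clm_apply_apply hGa hPb, fderiv_clm_apply_const hG, fderiv_clm_apply_const hP]
    filter_upwards [eventually_mem_source x₀] with y hy
    rw [metricInChart_apply, endoInChart_apply, ofChart_toChart hy]
    rfl
  rw [extDerivTwo, e1, e2, e3, hd0, hd0,
    mlieBracket_eq_fderiv (fieldInChart_coordField x₀ a) (fieldInChart_coordField x₀ b),
    mlieBracket_eq_fderiv (fieldInChart_coordField x₀ b) (Filter.EventuallyEq.refl _ X),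
    mlieBracket_eq_fderiv (Filter.EventuallyEq.refl _ X) (fieldInChart_coordField x₀ a)] at h
  simp only [coordField, endoInChart_self, metricInChart_self, hM.phi_xi, fderiv_fun_const,
    Pi.zero_apply, zero_apply, map_zero, sub_zero, zero_sub, map_neg, neg_apply] at h
  change 1 / 3 * (0 + 0 + _ - G p (fderiv ℝ X p b) (P p a) - -G p (fderiv ℝ X p a) (P p b)) = 0
    at h
  linarith

/-- On a `C`-manifold the forms `η^α` are parallel, expressed in the chart at `x₀`. -/
theorem IsCManifold.fderiv_eta_inChart [CompleteSpace E] (hM : IsCManifold g φ ξ η) (x₀ : M)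
    (α : Fin s) (u v : TangentSpace 𝓘(ℝ, E) x₀) :
    fderiv ℝ (formInChart x₀ (η α)) (extChartAt 𝓘(ℝ, E) x₀ x₀) (toChart x₀ x₀ u)
      (toChart x₀ x₀ v) = christoffelForm g x₀ u v (ξ α x₀) := by
  set p := extChartAt 𝓘(ℝ, E) x₀ x₀ with hp
  have hG : DifferentiableAt ℝ (metricInChart g x₀) p := differentiableAt_metricInChart g x₀
  have hP : DifferentiableAt ℝ (endoInChart x₀ φ) p := differentiableAt_endoInChart hM.smooth_phi
  have hX : ∀ α, DifferentiableAt ℝ (fieldInChart x₀ (ξ α)) p := fun α =>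
    differentiableAt_fieldInChart (hM.smooth_xi α)
  have hη : ∀ α, DifferentiableAt ℝ (formInChart x₀ (η α)) p := fun α =>
    differentiableAt_formInChart (hM.smooth_eta α)
  have hev : ∀ᶠ y in 𝓝 p, IsFramedPhiForm (metricInChart g x₀ y) (endoInChart x₀ φ y)
      (fun α => fieldInChart x₀ (ξ α) y) (fun α => formInChart x₀ (η α) y) := by
    filter_upwards [eventually_mem_source x₀] with y hy
    exact isFramedPhiForm_inChart hM.toIsFramedPhiStructure hy
  have h1 : ∀ α a c, fderiv ℝ (formInChart x₀ (η α)) p c a =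
      fderiv ℝ (metricInChart g x₀) p c a (fieldInChart x₀ (ξ α) p) +
        metricInChart g x₀ p a (fderiv ℝ (fieldInChart x₀ (ξ α)) p c) := by
    intro α a c
    have he : (fun y => formInChart x₀ (η α) y a) =ᶠ[𝓝 p]
        fun y => metricInChart g x₀ y a (fieldInChart x₀ (ξ α) y) :=
      hev.mono fun y hy => hy.eta_eq α a
    rw [← fderiv_clm_apply_const (hη α), he.fderiv_eq,
      fderiv_clm_apply_apply (hG.clm_apply (differentiableAt_const a)) (hX α),
      fderiv_clm_apply_const hG]
  have h2 : ∀ α β c, fderiv ℝ (formInChart x₀ (η α)) p c (fieldInChart x₀ (ξ β) p) +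
      formInChart x₀ (η α) p (fderiv ℝ (fieldInChart x₀ (ξ β)) p c) = 0 := by
    intro α β c
    have he : (fun y => formInChart x₀ (η α) y (fieldInChart x₀ (ξ β) y)) =ᶠ[𝓝 p]
        fun _ => if α = β then 1 else 0 := hev.mono fun y hy => hy.eta_xi α β
    rw [← fderiv_clm_apply_apply (hη α) (hX β), he.fderiv_eq]
    simp
  have h3 : ∀ α c, fderiv ℝ (endoInChart x₀ φ) p c (fieldInChart x₀ (ξ α) p) +
      endoInChart x₀ φ p (fderiv ℝ (fieldInChart x₀ (ξ α)) p c) = 0 := by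
    intro α c
    have he : (fun y => endoInChart x₀ φ y (fieldInChart x₀ (ξ α) y)) =ᶠ[𝓝 p] fun _ => 0 :=
      hev.mono fun y hy => hy.phi_xi α
    rw [← fderiv_clm_apply_apply hP (hX α), he.fderiv_eq]
    simp
  have h4 : ∀ α b c, fderiv ℝ (formInChart x₀ (η α)) p c (endoInChart x₀ φ p b) +
      formInChart x₀ (η α) p (fderiv ℝ (endoInChart x₀ φ) p c b) = 0 := by
    intro α b c
    have he : (fun y => formInChart x₀ (η α) y (endoInChart x₀ φ y b)) =ᶠ[𝓝 p] fun _ => 0 :=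
      hev.mono fun y hy => hy.eta_phi α b
    rw [← fderiv_clm_apply_const hP,
      ← fderiv_clm_apply_apply (hη α) (hP.clm_apply (differentiableAt_const b)), he.fderiv_eq]
    simp
  rw [christoffelForm_apply]
  refine (hev.self_of_nhds.eta_parallel h1 h2 h3 h4
    (fun α => fderiv_formInChart_symm (hη α) (hM.closed_eta α))
    (hM.normal_inChart x₀) (hM.closed_omega_inChart x₀) α _ _).trans ?_
  rw [fieldInChart_self x₀ (ξ α)]

end Parallel

/-! ### Differentiation along a curve -/

section AlongCurve

variable {E : Type*} [NormedAddCommGroup E] [NormedSpace ℝ E]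
  {M : Type*} [TopologicalSpace M] [ChartedSpace E M] [IsManifold 𝓘(ℝ, E) ∞ M]

lemma hasDerivWithinAt_clm_comp_apply {F F' F'' : Type*} [NormedAddCommGroup F] [NormedSpace ℝ F]
    [NormedAddCommGroup F'] [NormedSpace ℝ F'] [NormedAddCommGroup F''] [NormedSpace ℝ F'']
    {T : F → F' →L[ℝ] F''} {u : ℝ → F} {W : ℝ → F'} {u' : F} {W' : F'} {J : Set ℝ} {t : ℝ}
    (hT : DifferentiableAt ℝ T (u t)) (hu : HasDerivWithinAt u u' J t)
    (hW : HasDerivWithinAt W W' J t) :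
    HasDerivWithinAt (fun r => T (u r) (W r)) (fderiv ℝ T (u t) u' (W t) + T (u t) W') J t :=
  (hT.hasFDerivAt.comp_hasDerivWithinAt t hu).clm_apply hW

lemma hasDerivWithinAt_extChartAt_comp {γ : ℝ → M} {J : Set ℝ} {t : ℝ}
    (hγ : ContMDiffWithinAt 𝓘(ℝ, ℝ) 𝓘(ℝ, E) ∞ γ J t) :
    HasDerivWithinAt (fun r => extChartAt 𝓘(ℝ, E) (γ t) (γ r))
      (toChart (γ t) (γ t) (velocity γ J t)) J t := by
  have h := (hγ.mdifferentiableWithinAt (by simp)).hasMFDerivWithinAt.2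
  simp only [mfld_simps] at h
  rw [toChart_self]
  exact HasFDerivWithinAt.hasDerivWithinAt (F := E) h

variable {s : ℕ} {g : Metric E M}
  {φ : ∀ x : M, TangentSpace 𝓘(ℝ, E) x →L[ℝ] TangentSpace 𝓘(ℝ, E) x}
  {ξ : Fin s → ∀ x : M, TangentSpace 𝓘(ℝ, E) x}
  {η : Fin s → ∀ x : M, TangentSpace 𝓘(ℝ, E) x →L[ℝ] ℝ}

/-- Along any curve in a `C`-manifold, `(η^α(V))' = η^α(∇_{γ'} V)`. -/
theorem IsCManifold.hasDerivWithinAt_eta [FiniteDimensional ℝ E] (hM : IsCManifold g φ ξ η)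
    {γ : ℝ → M} {J : Set ℝ} {V : ∀ t : ℝ, TangentSpace 𝓘(ℝ, E) (γ t)} {t : ℝ} (ht : t ∈ J)
    (hγ : ContMDiffOn 𝓘(ℝ, ℝ) 𝓘(ℝ, E) ∞ γ J) (hV : SmoothAlong γ J V) (α : Fin s) :
    HasDerivWithinAt (fun r => η α (γ r) (V r)) (η α (γ t) (covDerivAlong g γ J V t)) J t := by
  have := FiniteDimensional.complete ℝ E
  let W : ℝ → E := fun r =>
    (trivializationAt E (TangentSpace 𝓘(ℝ, E) : M → Type _) (γ t) ⟨γ r, V r⟩).2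
  have hW : HasDerivWithinAt W (derivWithin W J t) J t := by
    have h1 := (contMDiffWithinAt_totalSpace.1 (hV t ht)).2
    exact ((contMDiffWithinAt_iff_contDiffWithinAt.1 h1).differentiableWithinAt
      (by simp)).hasDerivWithinAt
  have hu := hasDerivWithinAt_extChartAt_comp (hγ t ht)
  have hd := hasDerivWithinAt_clm_comp_apply
    (differentiableAt_formInChart (x₀ := γ t) (hM.smooth_eta α)) hu hW
  have hWt : W t = toChart (γ t) (γ t) (V t) :=
    trivializationAt_snd_eq_toChart (mem_chart_source E (γ t)) _
  have hcongr : ∀ r, γ r ∈ (chartAt E (γ t)).source → η α (γ r) (V r) =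
      formInChart (γ t) (η α) (extChartAt 𝓘(ℝ, E) (γ t) (γ r)) (W r) := by
    intro r hr
    have hr' : (extChartAt 𝓘(ℝ, E) (γ t)).symm (extChartAt 𝓘(ℝ, E) (γ t) (γ r)) = γ r :=
      (extChartAt 𝓘(ℝ, E) (γ t)).left_inv (by rwa [extChartAt_source])
    rw [formInChart_apply, hr', show W r = _ from trivializationAt_snd_eq_toChart hr _,
      ofChart_toChart hr]
  have hev : ∀ᶠ r in 𝓝[J] t, γ r ∈ (chartAt E (γ t)).source :=
    (hγ t ht).continuousWithinAt.eventually
      ((chartAt E (γ t)).open_source.mem_nhds (mem_chart_source E (γ t)))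
  have hd' := hd.congr_of_eventuallyEq (hev.mono hcongr) (hcongr t (mem_chart_source E (γ t)))
  refine hd'.congr_deriv ?_
  -- The coordinate derivative of `η^α` is exactly what the Christoffel term contributes.
  have hcov : covDerivAlong g γ J V t =
      ofChart (γ t) (γ t) (derivWithin W J t) + christoffel g (γ t) (velocity γ J t) (V t) := by
    rw [ofChart_self]
    rfl
  rw [hcov, map_add, formInChart_self, hM.eta_eq α _ (christoffel g (γ t) _ _), inner_christoffel,
    ← hM.fderiv_eta_inChart, hWt, add_comm]

end AlongCurve

/-! ### Invariant three-dimensional subspaces -/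

section Frenet

variable {E : Type*} [NormedAddCommGroup E] [NormedSpace ℝ E]
  {M : Type*} [TopologicalSpace M] [ChartedSpace E M] [IsManifold 𝓘(ℝ, E) ∞ M]
  {s : ℕ} {g : Metric E M}
  {φ : ∀ x : M, TangentSpace 𝓘(ℝ, E) x →L[ℝ] TangentSpace 𝓘(ℝ, E) x}
  {ξ : Fin s → ∀ x : M, TangentSpace 𝓘(ℝ, E) x}
  {η : Fin s → ∀ x : M, TangentSpace 𝓘(ℝ, E) x →L[ℝ] ℝ}

lemma IsFramedPhiStructure.inner_phi_left (hM : IsFramedPhiStructure g φ ξ η) {x : M}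
    (a b : TangentSpace 𝓘(ℝ, E) x) : g.inner x (φ x a) b = -g.inner x a (φ x b) := by
  have h1 := hM.metric_phi x a (φ x b)
  rw [hM.phi_sq] at h1
  simp only [map_add, map_neg, map_sum, map_smul, ← hM.eta_eq, hM.eta_phi, smul_eq_mul, mul_zero,
    Finset.sum_const_zero, add_zero, sub_zero] at h1
  linarith

lemma eq_of_mem_span_orthonormal {x : M} {e₁ e₂ e₃ w : TangentSpace 𝓘(ℝ, E) x}
    (h11 : g.inner x e₁ e₁ = 1) (h22 : g.inner x e₂ e₂ = 1) (h33 : g.inner x e₃ e₃ = 1)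
    (h12 : g.inner x e₁ e₂ = 0) (h13 : g.inner x e₁ e₃ = 0) (h23 : g.inner x e₂ e₃ = 0)
    (hw : w ∈ Submodule.span ℝ {e₁, e₂, e₃}) :
    w = g.inner x w e₁ • e₁ + g.inner x w e₂ • e₂ + g.inner x w e₃ • e₃ := by
  have h21 := (g.symm x e₂ e₁).trans h12
  have h31 := (g.symm x e₃ e₁).trans h13
  have h32 := (g.symm x e₃ e₂).trans h23
  obtain ⟨a, b, c, rfl⟩ := Submodule.mem_span_triple.1 hw
  simp [h11, h22, h33, h12, h13, h23, h21, h31, h32]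

/-- On a `φ`-invariant three-dimensional space with orthonormal basis `e₁, e₂, e₃` and `e₁`, `e₂`
orthogonal to all the `ξ_α`, the operator `φ` rotates the plane of `e₁`, `e₂`, and `e₃` is not
orthogonal to all the `ξ_α`. -/
lemma IsFramedPhiStructure.phi_of_invariant_span (hM : IsFramedPhiStructure g φ ξ η) {x : M}
    {e₁ e₂ e₃ : TangentSpace 𝓘(ℝ, E) x}
    (h11 : g.inner x e₁ e₁ = 1) (h22 : g.inner x e₂ e₂ = 1) (h33 : g.inner x e₃ e₃ = 1)
    (h12 : g.inner x e₁ e₂ = 0) (h13 : g.inner x e₁ e₃ = 0) (h23 : g.inner x e₂ e₃ = 0)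
    (hinv : ∀ w ∈ Submodule.span ℝ {e₁, e₂, e₃}, φ x w ∈ Submodule.span ℝ {e₁, e₂, e₃})
    (hη₁ : ∀ α, η α x e₁ = 0) (hη₂ : ∀ α, η α x e₂ = 0) :
    (∃ a : ℝ, φ x e₁ = a • e₂ ∧ φ x e₂ = -(a • e₁)) ∧ ∃ α, η α x e₃ ≠ 0 := by
  have h21 := (g.symm x e₂ e₁).trans h12
  have h31 := (g.symm x e₃ e₁).trans h13
  have h32 := (g.symm x e₃ e₂).trans h23
  have hself : ∀ w, g.inner x (φ x w) w = 0 := fun w => by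
    have h1 := hM.inner_phi_left w w
    have h2 := g.symm x w (φ x w)
    linarith
  have hskew : ∀ v w, g.inner x (φ x v) w = -g.inner x (φ x w) v := fun v w => by
    rw [hM.inner_phi_left, g.symm x v]
  have hexp := fun w hw => eq_of_mem_span_orthonormal h11 h22 h33 h12 h13 h23 (hinv w hw)
  have k1 := hexp e₁ (Submodule.subset_span (by simp))
  have k2 := hexp e₂ (Submodule.subset_span (by simp))
  have k3 := hexp e₃ (Submodule.subset_span (by simp))
  rw [hself, hskew e₂ e₁] at k2
  rw [hself] at k1
  rw [hself, hskew e₃ e₁, hskew e₃ e₂] at k3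
  -- The skew matrix of `φ` has entries `a`, `b`, `c`, and `φ` is isometric on the plane of
  -- `e₁`, `e₂`: `a² + b² = a² + c² = 1` and `b c = 0`.
  set a := g.inner x (φ x e₁) e₂
  set b := g.inner x (φ x e₁) e₃
  set c := g.inner x (φ x e₂) e₃
  have m11 := hM.metric_phi x e₁ e₁
  have m12 := hM.metric_phi x e₁ e₂
  have m22 := hM.metric_phi x e₂ e₂
  have m33 := hM.metric_phi x e₃ e₃
  rw [k1] at m11
  rw [k1, k2] at m12
  rw [k2] at m22
  rw [k3] at m33
  simp [h11, h22, h33, h12, h13, h23, h21, h31, h32, hη₁, hη₂] at m11 m12 m22 m33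
  have hb : b = 0 := by
    rcases m12 with h | h
    · exact h
    · nlinarith
  have hc : c = 0 := by nlinarith
  refine ⟨⟨a, ?_, ?_⟩, ?_⟩
  · rw [k1, hb]; simp
  · rw [k2, hc]; simp
  -- Otherwise `φ e₃` would be a unit vector, while `b = c = 0`.
  · by_contra! hη₃
    simp [hη₃] at m33
    nlinarith

end Frenet

/-! ### Legendre helices -/

section Legendre

variable {E : Type*} [NormedAddCommGroup E] [NormedSpace ℝ E] [FiniteDimensional ℝ E]
  {M : Type*} [TopologicalSpace M] [ChartedSpace E M] [IsManifold 𝓘(ℝ, E) ∞ M]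
  {s : ℕ} {g : Metric E M}
  {φ : ∀ x : M, TangentSpace 𝓘(ℝ, E) x →L[ℝ] TangentSpace 𝓘(ℝ, E) x}
  {ξ : Fin s → ∀ x : M, TangentSpace 𝓘(ℝ, E) x}
  {η : Fin s → ∀ x : M, TangentSpace 𝓘(ℝ, E) x →L[ℝ] ℝ}
  {γ : ℝ → M} {J : Set ℝ}

omit [FiniteDimensional ℝ E] in
lemma IsUnitSpeedCurve.uniqueDiffOn (h : IsUnitSpeedCurve g γ J) : UniqueDiffOn ℝ J := by
  refine uniqueDiffOn_convex h.interval.convex ?_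
  obtain ⟨a, ha, b, hb, hab⟩ := h.nontrivial.exists_lt
  exact ⟨(a + b) / 2, interior_mono (h.interval.out ha hb) (by
    rw [interior_Icc]; constructor <;> linarith)⟩

omit [FiniteDimensional ℝ E] in
lemma IsUnitSpeedCurve.smoothAlong_velocity (h : IsUnitSpeedCurve g γ J) :
    SmoothAlong (E := E) γ J (velocity γ J) := by
  have h1 := h.smooth.contMDiffOn_tangentMapWithin (m := ∞) (by simp) h.uniqueDiffOn.uniqueMDiffOn
  have h2 : ContMDiffOn 𝓘(ℝ, ℝ) 𝓘(ℝ, ℝ).tangent ∞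
      (fun t : ℝ => (⟨t, (1 : ℝ)⟩ : TangentBundle 𝓘(ℝ, ℝ) ℝ)) J :=
    contMDiffOn_vectorSpace_iff_contDiffOn.2 contDiffOn_const
  exact h1.comp h2 fun t ht => ht

lemma IsCManifold.eta_covDerivAlong_eq_zero (hM : IsCManifold g φ ξ η)
    (hγ : IsUnitSpeedCurve g γ J) {V : ∀ t : ℝ, TangentSpace 𝓘(ℝ, E) (γ t)}
    (hV : SmoothAlong γ J V) (α : Fin s) (h0 : ∀ t ∈ J, η α (γ t) (V t) = 0) {t : ℝ} (ht : t ∈ J) :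
    η α (γ t) (covDerivAlong g γ J V t) = 0 := by
  have h1 := hM.hasDerivWithinAt_eta ht hγ.smooth hV α
  have h2 : HasDerivWithinAt (fun r => η α (γ r) (V r)) 0 J t :=
    (hasDerivWithinAt_const t J (0 : ℝ)).congr h0 (h0 t ht)
  exact (hγ.uniqueDiffOn t ht).eq_deriv _ h1 h2

/-- A Legendre `φ`-helix in a `C`-manifold has `κ₂ = 0` and is a `φ`-circle. -/
theorem IsCManifold.isPhiCircle_of_isPhiHelix (hM : IsCManifold g φ ξ η)
    {v₂ v₃ : ∀ t : ℝ, TangentSpace 𝓘(ℝ, E) (γ t)} {κ₁ κ₂ : ℝ → ℝ}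
    (hL : IsLegendre g ξ γ J) (hH : IsPhiHelix g φ γ J v₂ v₃ κ₁ κ₂) :
    (∀ t ∈ J, κ₂ t = 0) ∧ IsPhiCircle g φ ξ γ J v₂ κ₁ := by
  have hγ := hH.toIsUnitSpeedCurve
  have hη₁ : ∀ α, ∀ t ∈ J, η α (γ t) (velocity γ J t) = 0 := fun α t ht => by
    rw [hM.eta_eq]; exact hL t ht α
  have hη₂ : ∀ α, ∀ t ∈ J, η α (γ t) (v₂ t) = 0 := fun α t ht => by
    have h := hM.eta_covDerivAlong_eq_zero hγ hγ.smoothAlong_velocity α (hη₁ α) ht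
    rw [hH.frenet_one t ht, map_smul, smul_eq_mul] at h
    exact (mul_eq_zero.1 h).resolve_left (hH.curv_one_pos t ht).ne'
  have hη₃ : ∀ α, ∀ t ∈ J, κ₂ t * η α (γ t) (v₃ t) = 0 := fun α t ht => by
    have h := hM.eta_covDerivAlong_eq_zero hγ hH.smooth_two α (hη₂ α) ht
    rw [hH.frenet_two t ht, map_add, map_neg, map_smul, map_smul, hη₁ α t ht, smul_zero, neg_zero,
      zero_add, smul_eq_mul] at h
    exact h
  have key := fun t ht => hM.phi_of_invariant_span (hH.unit_speed t ht) (hH.norm_two t ht)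
    (hH.norm_three t ht) (hH.orth_one_two t ht) (hH.orth_one_three t ht) (hH.orth_two_three t ht)
    (hH.invariant t ht) (fun α => hη₁ α t ht) (fun α => hη₂ α t ht)
  have hκ : ∀ t ∈ J, κ₂ t = 0 := fun t ht => by
    obtain ⟨α, hα⟩ := (key t ht).2
    exact (mul_eq_zero.1 (hη₃ α t ht)).resolve_right hα
  refine ⟨hκ, ?_⟩
  refine
    { toIsUnitSpeedCurve := hγ
      smooth_two := hH.smooth_two
      norm_two := hH.norm_two
      orth_one_two := hH.orth_one_two
      curv_one_pos := hH.curv_one_pos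
      frenet_one := hH.frenet_one
      frenet_two := fun t ht => ?_
      const_one := hH.const_one
      invariant := fun t ht w hw => ?_ }
  · rw [hH.frenet_two t ht, hκ t ht, zero_smul, add_zero]
  · obtain ⟨a, h₁, h₂⟩ := (key t ht).1
    induction hw using Submodule.span_induction with
    | mem w hw =>
      rcases hw with (rfl | rfl) | ⟨α, rfl⟩
      · rw [h₁]
        exact Submodule.smul_mem _ _ (Submodule.subset_span (by simp))
      · rw [h₂]
        exact Submodule.neg_mem _ (Submodule.smul_mem _ _ (Submodule.subset_span (by simp)))
      · rw [hM.phi_xi]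
        exact Submodule.zero_mem _
    | zero => rw [map_zero]; exact Submodule.zero_mem _
    | add u v _ _ hu hv => rw [map_add]; exact Submodule.add_mem _ hu hv
    | smul c u _ hu => rw [map_smul]; exact Submodule.smul_mem _ c hu

end Legendre

end CMfd

end

theorem mainTheorem4 {n s : ℕ}
    {M : Type*} [TopologicalSpace M] [ChartedSpace (EuclideanSpace ℝ (Fin (2 * n + s))) M]
    [IsManifold (𝓡 (2 * n + s)) ∞ M]
    (g : CMfd.Metric (EuclideanSpace ℝ (Fin (2 * n + s))) M)
    (φ : ∀ x : M, TangentSpace (𝓡 (2 * n + s)) x →L[ℝ] TangentSpace (𝓡 (2 * n + s)) x)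
    (ξ : Fin s → ∀ x : M, TangentSpace (𝓡 (2 * n + s)) x)
    (η : Fin s → ∀ x : M, TangentSpace (𝓡 (2 * n + s)) x →L[ℝ] ℝ)
    (hM : CMfd.IsCManifold g φ ξ η)
    (γ : ℝ → M) (J : Set ℝ)
    (v₂ v₃ : ∀ t : ℝ, TangentSpace (𝓡 (2 * n + s)) (γ t)) (κ₁ κ₂ : ℝ → ℝ)
    (hLegendre : CMfd.IsLegendre g ξ γ J)
    (hHelix : CMfd.IsPhiHelix g φ γ J v₂ v₃ κ₁ κ₂) :
    (∀ t ∈ J, κ₂ t = 0) ∧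
      CMfd.IsLegendre g ξ γ J ∧ CMfd.IsPhiCircle g φ ξ γ J v₂ κ₁ := by
  obtain ⟨hκ, hcircle⟩ := hM.isPhiCircle_of_isPhiHelix hLegendre hHelix
  exact ⟨hκ, hLegendre, hcircle⟩
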